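/- Let $K$ be a field and let $n>m\ge 2$ and $t\ge 1$ be integers. Let $S=K[x_1,\dots,x_n]$ and $S'=K[x_1,\dots,x_{n-1}]\subset S$. For $1\le m\le p$ let $I_{p,m}=(x_i x_{i+1}\cdots x_{i+m-1} : 1\le i\le p-m+1)$ be the $m$-path ideal of the path graph on $p$ vertices, an ideal of $K[x_1,\dots,x_p]$. Let $$J=J_{n,m}=I_{n,m}+(x_{n-m+2}\cdots x_nx_1,\ x_{n-m+3}\cdots x_nx_1x_2,\ \dots,\ x_nx_1\cdots x_{m-1})\subset S$$ be the $m$-path ideal of the cycle graph on $n$ vertices, and let $I=I_{n-1,m}\subset S'$ and $J'=(J:x_n)\cap S'$. Ideals of $S'$ are extended to $S$ where necessary. Then: 1. $(J^t,x_n^k)=(I^{t+1-k}J^{k-1},x_n^k)$ for all $1\le k\le t$. 2. $((J^t:x_n^{k-1}),x_n)=(I^{t+1-k}J'^{\,k-1},x_n)$ for all $1\le k\le t$. 3. $(J^t,x_n)=(I^t,x_n)$ and $(J^t:x_n^t)=J'^{\,t}S$. 4. $\operatorname{depth}(S/J^t)\le\operatorname{depth}(S'/J'^{\,t})+1$ and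 $\operatorname{sdepth}(S/J^t)\le\operatorname{sdepth}(S'/J'^{\,t})+1$. Here, over a polynomial ring $R$ over $K$ (with $R=S$ or $R=S'$), the depth of a module $M$ is the supremum of the lengths of the $M$-regular sequences in the ideal generated by the variables. For a monomial ideal $L\subsetneq R$, a Stanley decomposition of $R/L$ is a finite decomposition $R/L=\bigoplus_{i=1}^r u_iK[Z_i]$ into $K$-subspaces, where the $u_i$ are monomials, the $Z_i$ are sets of variables, $u_iK[Z_i]$ denotes the image of the map $K[Z_i]\to R/L$, $p\mapsto u_ip$, and these maps are injective; $\operatorname{sdepth}(R/L)$ is the maximum of $\min_i|Z_i|$ over all Stanley decompositions of $R/L$. -/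

import Mathlib

namespace CyclePath

open MvPolynomial

/-- The `m`-path ideal `I_{n,m} = (x₁⋯x_m, x₂⋯x_{m+1}, …, x_{n-m+1}⋯x_n)` of the path graph on
`n` vertices. The variables are indexed from `0`: the variable `x_i` is `X ⟨i - 1, _⟩`. -/
noncomputable def pathIdeal (K : Type*) [Field K] (n m : ℕ) : Ideal (MvPolynomial (Fin n) K) :=
  Ideal.span {f | ∃ i : ℕ, i + m ≤ n ∧
    f = ∏ l : Fin n with i ≤ l.val ∧ l.val < i + m, X l}

/-- The `m`-path ideal `J_{n,m}` of the cycle graph on `n` vertices: `I_{n,m}` together with the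
products of `m` cyclically consecutive variables that wrap around from `x_n` to `x_1`, that is
`x_{n-m+2}⋯x_n x_1, …, x_n x_1⋯x_{m-1}`. -/
noncomputable def cycleIdeal (K : Type*) [Field K] (n m : ℕ) : Ideal (MvPolynomial (Fin n) K) :=
  pathIdeal K n m ⊔ Ideal.span {f | ∃ i : ℕ, i < n ∧ n < i + m ∧
    f = ∏ l : Fin n with i ≤ l.val ∨ l.val + n < i + m, X l}

/-- The inclusion of `S' = K[x₁, …, x_{n-1}]` in `S = K[x₁, …, x_n]`. -/
noncomputable def incl (K : Type*) [Field K] (n : ℕ) :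
    MvPolynomial (Fin (n - 1)) K →+* MvPolynomial (Fin n) K :=
  (rename (Fin.castLE (Nat.sub_le n 1))).toRingHom

/-- The depth of a module `M` over `K[x_i : i ∈ σ]`: the supremum of the lengths of the
`M`-regular sequences in the ideal `(x_i : i ∈ σ)`. -/
noncomputable def depth (K : Type*) [Field K] (σ : Type*) (M : Type*) [AddCommGroup M]
    [Module (MvPolynomial σ K) M] : ℕ∞ :=
  ⨆ (rs : List (MvPolynomial σ K))
    (_ : (∀ r ∈ rs, r ∈ Ideal.span (Set.range (X : σ → MvPolynomial σ K))) ∧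
      RingTheory.Sequence.IsRegular M rs), (rs.length : ℕ∞)

/-- The `K`-linear map `K[Z] → S/I`, `p ↦ x^a p`. Its range is the subspace `x^a K[Z]` of `S/I`. -/
noncomputable def stanleyMap {K : Type*} [Field K] {σ : Type*} (I : Ideal (MvPolynomial σ K))
    (a : σ →₀ ℕ) (Z : Finset σ) :
    supported K (Z : Set σ) →ₗ[K] MvPolynomial σ K ⧸ I :=
  (Ideal.Quotient.mkₐ K I).toLinearMap ∘ₗ LinearMap.mulLeft K (monomial a (1 : K)) ∘ₗ
    (supported K (Z : Set σ)).val.toLinearMap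

/-- A Stanley decomposition `S/I = ⨁ x^{a_i} K[Z_i]` (a finite direct sum of `K`-subspaces) of the
quotient of a polynomial ring `S` by a monomial ideal `I`. As usual, each `x^{a_i} K[Z_i]` has to
be a Stanley space, i.e. free over `K[Z_i]`: multiplication `K[Z_i] → S/I` by `x^{a_i}` is
injective. All the summands are spanned by residue classes of monomials, hence are graded by the
exponent vectors. -/
structure StanleyDecomposition {K : Type*} [Field K] {σ : Type*}
    (I : Ideal (MvPolynomial σ K)) where
  r : ℕ
  a : Fin r → σ →₀ ℕ
  Z : Fin r → Finset σ
  free : ∀ i, Function.Injective (stanleyMap I (a i) (Z i))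
  isInternal : DirectSum.IsInternal fun i => LinearMap.range (stanleyMap I (a i) (Z i))

/-- The Stanley depth of a Stanley decomposition: the least number of variables `|Z_i|`. -/
noncomputable def StanleyDecomposition.sdepth {K : Type*} [Field K] {σ : Type*}
    {I : Ideal (MvPolynomial σ K)} (D : StanleyDecomposition I) : ℕ∞ :=
  ⨅ i, ((D.Z i).card : ℕ∞)

/-- The Stanley depth of `S/I`, for a monomial ideal `I` of a polynomial ring `S`. -/
noncomputable def sdepth {K : Type*} [Field K] {σ : Type*} (I : Ideal (MvPolynomial σ K)) : ℕ∞ :=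
  ⨆ D : StanleyDecomposition I, D.sdepth

end CyclePath

/-!
Write `x` for the last variable. Then `J = I + x J'` with `I ≤ J'`, both extended from `S'`, so the
coefficients of `x ^ j` of the elements of `J ^ t` form the ideal `I ^ (t - j) * J' ^ min j t` of
`S'`. The colon ideals are read off from these coefficient ideals, which increase to `J' ^ t`.

For the depth, let `𝔪` be the ideal of the variables of `S'` and let `L` be an ideal of `S'[x]`
that is homogeneous in `x`. If `S'[x] ⧸ L` has depth at least two, then `L : 𝔪 ≤ L + x (L : 𝔪)`; by
induction on the degree in `x`, no coefficient ideal `Q` of `L` is properly contained in `Q : 𝔪`.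
There are only finitely many coefficient ideals, so some `f` in `𝔪` is regular modulo all of them.
Dividing by `f` lowers all depths by one, and the inequality follows by induction.

For the Stanley depth, a Stanley decomposition of `S ⧸ J ^ t` is a partition of the monomials
outside `J ^ t` into cones. Its slice at `x`-degree `t` is such a partition for `J' ^ t`, and every
cone loses at most one dimension.
-/

namespace CyclePath

section Grade

open RingTheory.Sequence CategoryTheory Abelian Limits Pointwise

/-- The grade of the ideal `I` on the module `M`: the supremum of the lengths of the `M`-regular
sequences in `I`. -/
noncomputable def grade {A : Type*} [CommRing A] (I : Ideal A) (M : Type*) [AddCommGroup M]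
    [Module A M] : ℕ∞ :=
  ⨆ (rs : List A) (_ : (∀ r ∈ rs, r ∈ I) ∧ IsRegular M rs), (rs.length : ℕ∞)

universe u

variable {A : Type u} [CommRing A] {I : Ideal A} {M : Type u} [AddCommGroup M] [Module A M]

lemma natCast_le_grade_iff_subsingleton_ext [IsNoetherianRing A] [Module.Finite A M]
    (hI : I • (⊤ : Submodule A M) ≠ ⊤) {d : ℕ} :
    (d : ℕ∞) ≤ grade I M ↔
      ∀ i < d, Subsingleton (Ext (ModuleCat.of A (Shrink.{u} (A ⧸ I))) (ModuleCat.of A M) i) := by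
  have rees := fun n ↦ (ModuleCat.exists_isRegular_tfae I n (ModuleCat.of A M) hI.lt_top).out 1 3
  constructor
  · intro hd i hi
    obtain ⟨rs, hrs, hlen⟩ :
        ∃ rs : List A, ((∀ r ∈ rs, r ∈ I) ∧ IsRegular M rs) ∧ i < rs.length := by
      simpa [grade, lt_iSup_iff] using (Nat.cast_lt.mpr hi).trans_le hd
    exact (rees _).mpr ⟨rs, rfl, hrs.1, hrs.2⟩ i hlen
  · intro h
    obtain ⟨rs, rfl, hmem, hreg⟩ := (rees d).mp h
    exact le_iSup₂_of_le rs ⟨hmem, hreg⟩ le_rfl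

lemma natCast_le_grade_iff_exists_isRegular [IsNoetherianRing A] [Module.Finite A M]
    (hI : I • (⊤ : Submodule A M) ≠ ⊤) {d : ℕ} :
    (d : ℕ∞) ≤ grade I M ↔
      ∃ rs : List A, rs.length = d ∧ (∀ r ∈ rs, r ∈ I) ∧ IsRegular M rs :=
  (natCast_le_grade_iff_subsingleton_ext hI).trans
    ((ModuleCat.exists_isRegular_tfae I d (ModuleCat.of A M) hI.lt_top).out 1 3)

lemma smul_top_quotSMulTop_ne_top {f : A} (hf : f ∈ I) (hI : I • (⊤ : Submodule A M) ≠ ⊤) :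
    I • (⊤ : Submodule A (QuotSMulTop f M)) ≠ ⊤ := by
  refine fun h ↦ hI ?_
  have hle : f • (⊤ : Submodule A M) ≤ I • ⊤ := by
    rw [← Submodule.ideal_span_singleton_smul]
    exact Submodule.smul_mono_left ((Ideal.span_singleton_le_iff_mem I).mpr hf)
  simpa [Submodule.comap_smul_top_of_surjective I _ (Submodule.mkQ_surjective _), hle]
    using congrArg (Submodule.comap (Submodule.mkQ _)) h

lemma grade_quotSMulTop_add_one [IsNoetherianRing A] [Module.Finite A M] {f : A} (hfI : f ∈ I)
    (hf : IsSMulRegular M f) (hI : I • (⊤ : Submodule A M) ≠ ⊤) :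
    grade I (QuotSMulTop f M) + 1 = grade I M := by
  have hI' := smul_top_quotSMulTop_ne_top hfI hI
  refine ENat.eq_of_forall_natCast_le_iff fun d ↦ ?_
  rcases d with _ | d
  · simp
  rw [Nat.cast_succ, (ENat.addLECancellable_of_ne_top ENat.one_ne_top).add_le_add_iff_right]
  constructor
  · rw [natCast_le_grade_iff_exists_isRegular hI', ← Nat.cast_succ,
      natCast_le_grade_iff_exists_isRegular hI]
    rintro ⟨rs, rfl, hmem, hreg⟩
    exact ⟨f :: rs, rfl, List.forall_mem_cons.mpr ⟨hfI, hmem⟩,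
      (isRegular_cons_iff M f rs).mpr ⟨hf, hreg⟩⟩
  · rw [natCast_le_grade_iff_subsingleton_ext hI', ← Nat.cast_succ,
      natCast_le_grade_iff_subsingleton_ext hI]
    intro h i hi
    have hi₀ := AddCommGrpCat.isZero_of_iff_subsingleton.mpr (h i (by omega))
    have hi₁ := AddCommGrpCat.isZero_of_iff_subsingleton.mpr (h (i + 1) (by omega))
    exact AddCommGrpCat.subsingleton_of_isZero <| ShortComplex.Exact.isZero_of_both_zeros
      (Ext.covariant_sequence_exact₃' _
        (IsSMulRegular.smulShortComplex_shortExact (M := ModuleCat.of A M) hf) i (i + 1) rfl)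
      (hi₀.eq_zero_of_src _) (hi₁.eq_zero_of_tgt _)

lemma grade_le_grade_of_addEquiv {A B M N : Type*} [CommRing A] [CommRing B] [AddCommGroup M]
    [AddCommGroup N] [Module A M] [Module B N] {I : Ideal A} {L : Ideal B} (e : M ≃+ N) {φ : A → B}
    (he : ∀ r x, e (r • x) = φ r • e x) (hφ : ∀ r ∈ I, φ r ∈ L) : grade I M ≤ grade L N := by
  refine iSup₂_le fun rs hrs ↦ le_iSup₂_of_le (rs.map φ) ⟨?_, ?_⟩ (by rw [List.length_map])
  · exact List.forall_mem_map.mpr fun r hr ↦ hφ r (hrs.1 r hr)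
  · exact (e.isRegular_congr (List.forall₂_map_right_iff.mpr
      (List.forall₂_same.mpr fun r _ ↦ he r))).mp hrs.2

lemma grade_quotient_le_grade_map {A B : Type*} [CommRing A] [CommRing B] (e : A ≃+* B)
    (I Q : Ideal A) : grade I (A ⧸ Q) ≤ grade (I.map e) (B ⧸ Q.map e) :=
  grade_le_grade_of_addEquiv (Ideal.quotientEquiv Q (Q.map e) e rfl).toAddEquiv
    (φ := e) (fun r ↦ Ideal.Quotient.mk_surjective.forall.mpr fun a ↦
      congrArg (Ideal.Quotient.mk (Q.map e)) (map_mul e r a))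
    fun _ ↦ Ideal.mem_map_of_mem _

variable {Q : Ideal A} {f : A}

/-- The quotient of `A ⧸ Q` by `f` as a quotient of `A`. -/
noncomputable def quotSMulTopQuotientEquiv {A : Type*} [CommRing A] (Q : Ideal A) (f : A) :
    QuotSMulTop f (A ⧸ Q) ≃ₗ[A] A ⧸ (Q ⊔ Ideal.span {f}) :=
  (Submodule.quotEquivOfEq _ _ (by
    rw [← Submodule.ideal_span_singleton_smul, ← Submodule.range_mkQ Q, ← Submodule.map_top,
      ← Submodule.map_smul'', Ideal.smul_eq_mul, Ideal.mul_top])).trans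
  (Submodule.quotientQuotientEquivQuotientSup Q (Ideal.span {f}))

lemma smul_top_quotient_ne_top (hI : I ≠ ⊤) (hQ : Q ≤ I) :
    I • (⊤ : Submodule A (A ⧸ Q)) ≠ ⊤ := by
  refine fun h ↦ hI ?_
  calc
    I = I • ⊤ ⊔ Q := by rw [Ideal.smul_eq_mul, Ideal.mul_top, sup_eq_left.mpr hQ]
    _ = Submodule.comap Q.mkQ (I • ⊤) := by
      rw [Submodule.comap_smul_top_of_surjective I _ Q.mkQ_surjective, Submodule.ker_mkQ]
    _ = ⊤ := by rw [h, Submodule.comap_top]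

lemma grade_quotient_sup_span_singleton_add_one [IsNoetherianRing A] (hI : I ≠ ⊤) (hQ : Q ≤ I)
    (hfI : f ∈ I) (hf : IsSMulRegular (A ⧸ Q) f) :
    grade I (A ⧸ (Q ⊔ Ideal.span {f})) + 1 = grade I (A ⧸ Q) := by
  rw [← grade_quotSMulTop_add_one hfI hf (smul_top_quotient_ne_top hI hQ)]
  congr 1
  exact le_antisymm
    (grade_le_grade_of_addEquiv (φ := id) (quotSMulTopQuotientEquiv Q f).symm.toAddEquiv
      (quotSMulTopQuotientEquiv Q f).symm.map_smul fun _ ↦ id)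
    (grade_le_grade_of_addEquiv (φ := id) (quotSMulTopQuotientEquiv Q f).toAddEquiv
      (quotSMulTopQuotientEquiv Q f).map_smul fun _ ↦ id)

lemma exists_isSMulRegular_pair_of_two_le_grade (h : 2 ≤ grade I (A ⧸ Q)) :
    ∃ f ∈ I, ∃ g ∈ I, IsSMulRegular (A ⧸ Q) f ∧ IsSMulRegular (A ⧸ (Q ⊔ Ideal.span {f})) g := by
  obtain ⟨rs, ⟨hmem, hreg⟩, hlen⟩ :
      ∃ rs : List A, ((∀ r ∈ rs, r ∈ I) ∧ IsRegular (A ⧸ Q) rs) ∧ 1 < rs.length := by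
    simpa [grade, lt_iSup_iff] using (Nat.cast_lt.mpr one_lt_two).trans_le h
  match rs, hlen with
  | f :: g :: rs, _ =>
    rw [isRegular_cons_iff, isRegular_cons_iff] at hreg
    exact ⟨f, hmem f (by simp), g, hmem g (by simp), hreg.1,
      ((quotSMulTopQuotientEquiv Q f).isSMulRegular_congr g).mp hreg.2.1⟩

lemma exists_isSMulRegular_quotient_of_colon_le [IsNoetherianRing A] {ι : Type*} [Finite ι]
    (Q : ι → Ideal A) (h : ∀ i, (Q i).colon I ≤ Q i) :
    ∃ f ∈ I, ∀ i, IsSMulRegular (A ⧸ Q i) f := by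
  have : Subsingleton ((A ⧸ I) →ₗ[A] ∀ i, A ⧸ Q i) := by
    refine subsingleton_of_forall_eq 0 fun φ ↦ ?_
    ext i
    obtain ⟨a, ha⟩ := Ideal.Quotient.mk_surjective (φ 1 i)
    have hφ (b : A) : Ideal.Quotient.mk (Q i) (b * a) = φ (Ideal.Quotient.mk I b) i := by
      rw [map_mul, ha, show Ideal.Quotient.mk I b = b • 1 from Algebra.algebraMap_eq_smul_one b,
        map_smul]
      rfl
    have haI : a ∈ (Q i).colon I := Submodule.mem_colon.mpr fun b hb ↦ by
      rw [smul_eq_mul, mul_comm, ← Ideal.Quotient.eq_zero_iff_mem, hφ,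
        Ideal.Quotient.eq_zero_iff_mem.mpr hb, map_zero, Pi.zero_apply]
    change φ 1 i = 0
    rw [← ha, Ideal.Quotient.eq_zero_iff_mem]
    exact h i haI
  simpa [Ideal.annihilator_quotient] using IsSMulRegular.subsingleton_linearMap_iff.mp this

lemma colon_le_sup_span_singleton_mul_colon {x : A} (h : 2 ≤ grade (I ⊔ Ideal.span {x}) (A ⧸ Q)) :
    Q.colon I ≤ Q ⊔ Ideal.span {x} * Q.colon I := by
  obtain ⟨f, hf, g, hg, hfreg, hgreg⟩ := exists_isSMulRegular_pair_of_two_le_grade h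
  rw [isSMulRegular_quotient_iff_mem_of_smul_mem] at hfreg hgreg
  have decompose {y : A} (hy : y ∈ I ⊔ Ideal.span {x}) : ∃ i ∈ I, ∃ q, i + q * x = y := by
    simpa [Submodule.mem_sup, Ideal.mem_span_singleton'] using hy
  obtain ⟨l, hl, p, rfl⟩ := decompose hf
  obtain ⟨i, hi, q, rfl⟩ := decompose hg
  intro v hv
  -- For `v * I ≤ Q`, regularity of `i + q * x` modulo `(Q, l + p * x)` gives
  -- `p * v = a * (l + p * x)` modulo `Q`, and then `v = x * a` modulo `Q` with `a * I ≤ Q`.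
  replace hv : ∀ r ∈ I, v * r ∈ Q := fun r hr ↦ Submodule.mem_colon.mp hv r hr
  have hpv : p * v ∈ Q ⊔ Ideal.span {l + p * x} := by
    refine hgreg _ (Submodule.mem_sup.mpr
      ⟨p * (v * i) - q * (v * l), ?_, q * v * (l + p * x), ?_, ?_⟩)
    · exact Q.sub_mem (Q.mul_mem_left _ (hv i hi)) (Q.mul_mem_left _ (hv l hl))
    · exact Ideal.mul_mem_left _ _ (Ideal.mem_span_singleton_self _)
    · rw [smul_eq_mul]; ring
  obtain ⟨s, hs, a, hsa⟩ : ∃ s ∈ Q, ∃ a, s + a * (l + p * x) = p * v := by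
    simpa [Submodule.mem_sup, Ideal.mem_span_singleton'] using hpv
  have ha : a ∈ Q.colon I := Submodule.mem_colon.mpr fun r hr ↦ hfreg _ <| by
    convert Q.sub_mem (Q.mul_mem_left p (hv r hr)) (Q.mul_mem_left r hs) using 1
    simp only [smul_eq_mul]
    linear_combination r * hsa
  have hva : v - x * a ∈ Q := hfreg _ <| by
    convert Q.add_mem (hv l hl) (Q.mul_mem_left x hs) using 1
    simp only [smul_eq_mul]
    linear_combination -x * hsa
  rw [← sub_add_cancel v (x * a)]
  exact add_mem (Ideal.mem_sup_left hva)
    (Ideal.mem_sup_right (Ideal.mul_mem_mul (Ideal.mem_span_singleton_self x) ha))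

end Grade

section CoefficientSequence

open Polynomial

variable {R : Type*} [CommRing R]

/-- The ideal of the polynomials whose coefficient of `X ^ j` lies in `a j` for all `j`. For
monotone `a` these are the ideals of `R[X]` that are homogeneous with respect to `X`. -/
def ofCoeff (a : ℕ →o Ideal R) : Ideal R[X] where
  carrier := {p | ∀ j, p.coeff j ∈ a j}
  add_mem' hp hq j := by
    rw [coeff_add]
    exact add_mem (hp j) (hq j)
  zero_mem' j := by
    rw [coeff_zero]
    exact zero_mem _
  smul_mem' p q hq j := by
    rw [smul_eq_mul, coeff_mul]
    exact sum_mem fun i hi ↦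
      Ideal.mul_mem_left _ _ (a.monotone (Finset.HasAntidiagonal.antidiagonal.snd_le hi) (hq i.2))

variable {a b c : ℕ →o Ideal R}

lemma C_mul_X_pow_mem_ofCoeff {r : R} {j : ℕ} : C r * X ^ j ∈ ofCoeff a ↔ r ∈ a j := by
  refine ⟨fun h ↦ by simpa using h j, fun hr i ↦ ?_⟩
  rw [coeff_C_mul_X_pow]
  split_ifs with hi
  exacts [hi ▸ hr, zero_mem _]

lemma ofCoeff_le_iff {L : Ideal R[X]} :
    ofCoeff a ≤ L ↔ ∀ j, ∀ r ∈ a j, C r * X ^ j ∈ L := by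
  refine ⟨fun h j r hr ↦ h (C_mul_X_pow_mem_ofCoeff.mpr hr), fun h p hp ↦ ?_⟩
  rw [p.as_sum_range_C_mul_X_pow]
  exact sum_mem fun j _ ↦ h j _ (hp j)

lemma ofCoeff_mono (h : a ≤ b) : ofCoeff a ≤ ofCoeff b :=
  fun _ hp j ↦ h j (hp j)

lemma ofCoeff_const (Q : Ideal R) : ofCoeff (OrderHom.const ℕ Q) = Q.map C :=
  Ideal.ext fun _ ↦ Ideal.mem_map_C_iff.symm

lemma ofCoeff_sup (a b : ℕ →o Ideal R) : ofCoeff (a ⊔ b) = ofCoeff a ⊔ ofCoeff b := by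
  refine le_antisymm (ofCoeff_le_iff.mpr fun j r hr ↦ ?_)
    (sup_le (ofCoeff_mono le_sup_left) (ofCoeff_mono le_sup_right))
  obtain ⟨s, hs, t, ht, rfl⟩ := Submodule.mem_sup.mp hr
  rw [C_add, add_mul]
  exact add_mem (Ideal.mem_sup_left (C_mul_X_pow_mem_ofCoeff.mpr hs))
    (Ideal.mem_sup_right (C_mul_X_pow_mem_ofCoeff.mpr ht))

lemma ofCoeff_mul_le (h : ∀ i j, a i * b j ≤ c (i + j)) : ofCoeff a * ofCoeff b ≤ ofCoeff c := by
  refine Ideal.mul_le.mpr fun p hp q hq j ↦ ?_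
  rw [coeff_mul]
  refine sum_mem fun i hi ↦ ?_
  rw [← Finset.HasAntidiagonal.mem_antidiagonal.mp hi]
  exact h _ _ (Ideal.mul_mem_mul (hp _) (hq _))

lemma ofCoeff_colon_X_pow {t : ℕ} (h : ∀ j, b j = a (j + t)) :
    (ofCoeff a).colon {X ^ t} = ofCoeff b := by
  ext p
  rw [Submodule.mem_colon_singleton, smul_eq_mul]
  refine ⟨fun hp j ↦ ?_, fun hp j ↦ ?_⟩
  · rw [h, ← coeff_mul_X_pow p t j]
    exact hp (j + t)
  · rw [coeff_mul_X_pow']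
    split_ifs with hj
    · simpa [h, hj] using hp (j - t)
    · exact zero_mem _

lemma ofCoeff_sup_span_X (a : ℕ →o Ideal R) :
    ofCoeff a ⊔ Ideal.span {X} = (a 0).map C ⊔ Ideal.span {X} := by
  refine le_antisymm (sup_le (ofCoeff_le_iff.mpr ?_) le_sup_right)
    (sup_le_sup_right ?_ _)
  · rintro (_ | j) r hr
    · rw [pow_zero, mul_one]
      exact Ideal.mem_sup_left (Ideal.mem_map_of_mem C hr)
    · exact Ideal.mem_sup_right
        (Ideal.mem_span_singleton.mpr ((dvd_pow_self X j.succ_ne_zero).mul_left _))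
  · rw [← ofCoeff_const]
    exact ofCoeff_mono fun j ↦ a.monotone j.zero_le

lemma isSMulRegular_quotient_ofCoeff {f : R} (hf : ∀ j, IsSMulRegular (R ⧸ a j) f) :
    IsSMulRegular (R[X] ⧸ ofCoeff a) (C f) := by
  refine (isSMulRegular_quotient_iff_mem_of_smul_mem _ _).mpr fun p hp j ↦
    mem_of_isSMulRegular_quotient_of_smul_mem (hf j) ?_
  simpa using hp j

lemma colon_le_of_two_le_grade_quotient_ofCoeff {m : Ideal R}
    (h : 2 ≤ grade (m.map C ⊔ Ideal.span {X}) (R[X] ⧸ ofCoeff a)) (j : ℕ) :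
    (a j).colon m ≤ a j := by
  intro v hv
  have hvX : C v * X ^ j ∈ (ofCoeff a).colon (m.map C) := by
    refine Submodule.mem_colon.mpr fun p hp i ↦ ?_
    rw [smul_eq_mul, mul_assoc, X_pow_mul, coeff_C_mul, coeff_mul_X_pow']
    split_ifs with hi
    · exact a.monotone hi (Submodule.mem_colon.mp hv _ (Ideal.mem_map_C_iff.mp hp _))
    · rw [mul_zero]
      exact zero_mem _
  obtain ⟨s, hs, q, hq, hsq⟩ : ∃ s ∈ ofCoeff a, ∃ q ∈ (ofCoeff a).colon (m.map C),
      s + X * q = C v * X ^ j := by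
    simpa [Submodule.mem_sup, Ideal.mem_span_singleton_mul] using
      colon_le_sup_span_singleton_mul_colon h hvX
  have hv' : v = s.coeff j + (X * q).coeff j := by
    rw [← coeff_add, hsq, coeff_C_mul_X_pow, if_pos rfl]
  rw [hv']
  refine add_mem (hs j) ?_
  cases j with
  | zero => simp
  | succ j =>
    rw [coeff_X_mul]
    refine a.monotone j.le_succ (colon_le_of_two_le_grade_quotient_ofCoeff h j
      (Submodule.mem_colon.mpr fun r hr ↦ ?_))
    simpa using Submodule.mem_colon.mp hq (C r) (Ideal.mem_map_of_mem C hr) j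

lemma map_C_sup_span_X_ne_top {m : Ideal R} (hm : m ≠ ⊤) : m.map C ⊔ Ideal.span {X} ≠ ⊤ := by
  rw [Ideal.ne_top_iff_one] at hm ⊢
  have hle : m.map C ⊔ Ideal.span {X} ≤ m.comap constantCoeff :=
    sup_le (Ideal.map_le_iff_le_comap.mpr fun r hr ↦ by simpa using hr)
      ((Ideal.span_singleton_le_iff_mem _).mpr (by simp))
  exact fun h ↦ hm (by simpa using hle h)

lemma exists_isSMulRegular_of_two_le_grade_quotient_ofCoeff [IsNoetherianRing R] {m : Ideal R}
    (h : 2 ≤ grade (m.map C ⊔ Ideal.span {X}) (R[X] ⧸ ofCoeff a)) :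
    ∃ f ∈ m, ∀ j, IsSMulRegular (R ⧸ a j) f := by
  obtain ⟨n, hn⟩ := monotone_stabilizes_iff_noetherian.mpr inferInstance a
  obtain ⟨f, hf, hreg⟩ := exists_isSMulRegular_quotient_of_colon_le (I := m)
    (fun i : Fin (n + 1) ↦ a i) fun i ↦ colon_le_of_two_le_grade_quotient_ofCoeff h i
  refine ⟨f, hf, fun j ↦ ?_⟩
  rcases le_total n j with hj | hj
  · rw [← hn j hj]
    exact hreg (Fin.last n)
  · exact hreg ⟨j, Nat.lt_succ_of_le hj⟩

lemma natCast_le_grade_of_succ_le_grade_quotient_ofCoeff [IsNoetherianRing R] {m : Ideal R}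
    (hm : m ≠ ⊤) {j : ℕ} (d : ℕ) (hj : a j ≤ m)
    (hd : (d + 1 : ℕ∞) ≤ grade (m.map C ⊔ Ideal.span {X}) (R[X] ⧸ ofCoeff a)) :
    (d : ℕ∞) ≤ grade m (R ⧸ a j) := by
  induction d generalizing a with
  | zero => simp
  | succ d ih =>
    obtain ⟨f, hf, hreg⟩ := exists_isSMulRegular_of_two_le_grade_quotient_ofCoeff (a := a) (m := m)
      (le_trans (by norm_cast; omega) hd)
    have hle : ofCoeff a ≤ m.map C ⊔ Ideal.span {X} :=
      le_sup_left.trans ((ofCoeff_sup_span_X a).trans_le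
        (sup_le_sup_right (Ideal.map_mono ((a.monotone j.zero_le).trans hj)) _))
    rw [← grade_quotient_sup_span_singleton_add_one hm hj hf (hreg j), Nat.cast_succ]
    refine add_le_add_left (ih (a := a ⊔ OrderHom.const ℕ (Ideal.span {f})) ?_ ?_) 1
    · exact sup_le hj ((Ideal.span_singleton_le_iff_mem m).mpr hf)
    · rw [← grade_quotient_sup_span_singleton_add_one (map_C_sup_span_X_ne_top hm) hle
        (Ideal.mem_sup_left (Ideal.mem_map_of_mem C hf))
        (isSMulRegular_quotient_ofCoeff hreg)] at hd
      rw [ofCoeff_sup, ofCoeff_const, Ideal.map_span, Set.image_singleton]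
      exact (ENat.addLECancellable_of_ne_top ENat.one_ne_top).add_le_add_iff_right.mp hd

theorem grade_quotient_ofCoeff_le_add_one [IsNoetherianRing R] {m : Ideal R} (hm : m ≠ ⊤) {j : ℕ}
    (hj : a j ≤ m) :
    grade (m.map C ⊔ Ideal.span {X}) (R[X] ⧸ ofCoeff a) ≤ grade m (R ⧸ a j) + 1 := by
  refine ENat.forall_natCast_le_iff_le.mp fun d hd ↦ ?_
  rcases d with _ | d
  · simp
  · rw [Nat.cast_succ] at hd ⊢
    exact add_le_add_left (natCast_le_grade_of_succ_le_grade_quotient_ofCoeff hm d hj hd) 1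

end CoefficientSequence

section Powers

open Polynomial

variable {R : Type*} [CommRing R] {I J Y : Ideal R}

lemma sup_pow_add_le (I Y : Ideal R) (s k : ℕ) :
    (I ⊔ Y) ^ (s + k) ≤ I ^ s * (I ⊔ Y) ^ k ⊔ Y ^ (k + 1) := by
  rw [← Ideal.add_eq_sup, add_pow, Ideal.sum_eq_sup, Ideal.add_eq_sup]
  refine Finset.sup_le fun i hi ↦ Ideal.mul_le_left.trans ?_
  rw [Finset.mem_range] at hi
  rcases le_or_gt s i with hsi | his
  · refine le_sup_of_le_left ?_
    obtain ⟨d, rfl⟩ := Nat.exists_eq_add_of_le hsi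
    obtain ⟨d', rfl⟩ : ∃ d', k = d + d' := ⟨k - d, by omega⟩
    rw [show s + (d + d') - (s + d) = d' by omega, pow_add I, pow_add _ d, mul_assoc]
    gcongr
    exacts [le_sup_left, le_sup_right]
  · exact le_sup_of_le_right (Ideal.mul_le_right.trans (Ideal.pow_le_pow_right (by omega)))

lemma sup_pow_add_sup_span_pow {x : R} (hY : Y ≤ Ideal.span {x}) (s k : ℕ) :
    (I ⊔ Y) ^ (s + k) ⊔ Ideal.span {x ^ (k + 1)} =
      I ^ s * (I ⊔ Y) ^ k ⊔ Ideal.span {x ^ (k + 1)} := by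
  refine le_antisymm (sup_le ((sup_pow_add_le I Y s k).trans (sup_le_sup_left ?_ _)) le_sup_right)
    (sup_le_sup_right ?_ _)
  · rw [← Ideal.span_singleton_pow]
    exact Ideal.pow_right_mono hY _
  · rw [pow_add]
    gcongr
    exact le_sup_left

lemma pow_mul_pow_le_pow_mul_pow (h : I ≤ J) {a b c d : ℕ} (hca : c ≤ a)
    (hcd : c + d ≤ a + b) : I ^ a * J ^ b ≤ I ^ c * J ^ d := by
  obtain ⟨k, rfl⟩ := Nat.exists_eq_add_of_le hca
  calc
    I ^ (c + k) * J ^ b = I ^ c * (I ^ k * J ^ b) := by rw [pow_add, mul_assoc]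
    _ ≤ I ^ c * (J ^ k * J ^ b) := by gcongr
    _ = I ^ c * J ^ (k + b) := by rw [pow_add]
    _ ≤ I ^ c * J ^ d := Ideal.mul_mono_right (Ideal.pow_le_pow_right (by omega))

/-- The coefficient ideals of the power `(I + X J) ^ t` in `R[X]`, where `I ≤ J`. -/
def powCoeff (h : I ≤ J) (t : ℕ) : ℕ →o Ideal R where
  toFun j := I ^ (t - j) * J ^ min j t
  monotone' i j hij := pow_mul_pow_le_pow_mul_pow h (by omega) (by omega)

lemma powCoeff_apply (h : I ≤ J) (t j : ℕ) : powCoeff h t j = I ^ (t - j) * J ^ min j t :=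
  rfl

lemma powCoeff_self (h : I ≤ J) (t : ℕ) : powCoeff h t t = J ^ t := by
  rw [powCoeff_apply, Nat.sub_self, pow_zero, Ideal.one_eq_top, Ideal.top_mul, min_self]

lemma ofCoeff_powCoeff_mul_le (h : I ≤ J) (s t : ℕ) :
    ofCoeff (powCoeff h s) * ofCoeff (powCoeff h t) ≤ ofCoeff (powCoeff h (s + t)) := by
  refine ofCoeff_mul_le fun i j ↦ ?_
  calc
    powCoeff h s i * powCoeff h t j
    _ = I ^ (s - i + (t - j)) * J ^ (min i s + min j t) := by
      rw [powCoeff_apply, powCoeff_apply, pow_add, pow_add, mul_mul_mul_comm]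
    _ ≤ powCoeff h (s + t) (i + j) := pow_mul_pow_le_pow_mul_pow h (by omega) (by omega)

lemma map_C_sup_span_X_mul_map_C_le_ofCoeff (h : I ≤ J) :
    I.map C ⊔ Ideal.span {X} * J.map C ≤ ofCoeff (powCoeff h 1) := by
  have hI : I = powCoeff h 1 0 := by simp [powCoeff_apply]
  refine sup_le ?_ (Ideal.span_singleton_mul_le_iff.mpr fun p hp ↦ ?_)
  · rw [← ofCoeff_const]
    exact ofCoeff_mono fun j ↦ hI.trans_le ((powCoeff h 1).monotone j.zero_le)
  · rintro (_ | j)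
    · simp
    · simpa [powCoeff_apply] using Ideal.mem_map_C_iff.mp hp j

lemma C_mul_X_pow_mem_pow {r : R} {t j : ℕ} (hr : r ∈ I ^ (t - j) * J ^ min j t) :
    C r * X ^ j ∈ (I.map C ⊔ Ideal.span {X} * J.map C) ^ t := by
  have hCr : C r ∈ I.map C ^ (t - j) * J.map C ^ min j t := by
    rw [← Ideal.map_pow, ← Ideal.map_pow, ← Ideal.map_mul]
    exact Ideal.mem_map_of_mem C hr
  have hle : I.map C ^ (t - j) * J.map C ^ min j t * Ideal.span {X ^ min j t} ≤
      (I.map C ⊔ Ideal.span {X} * J.map C) ^ t := calc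
    _ = I.map C ^ (t - j) * (Ideal.span {X} * J.map C) ^ min j t := by
      rw [mul_assoc, mul_comm (J.map C ^ _), ← Ideal.span_singleton_pow, mul_pow]
    _ ≤ (I.map C ⊔ Ideal.span {X} * J.map C) ^ (t - j) *
        (I.map C ⊔ Ideal.span {X} * J.map C) ^ min j t := by
      gcongr
      exacts [le_sup_left, le_sup_right]
    _ = (I.map C ⊔ Ideal.span {X} * J.map C) ^ t := by
      rw [← pow_add, show t - j + min j t = t by omega]
  rw [← Nat.add_sub_cancel' (min_le_left j t), pow_add, ← mul_assoc]
  exact Ideal.mul_mem_right _ _ (hle (Ideal.mul_mem_mul hCr (Ideal.mem_span_singleton_self _)))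

lemma pow_eq_ofCoeff (h : I ≤ J) (t : ℕ) :
    (I.map C ⊔ Ideal.span {X} * J.map C) ^ t = ofCoeff (powCoeff h t) := by
  refine le_antisymm ?_ (ofCoeff_le_iff.mpr fun j r ↦ C_mul_X_pow_mem_pow)
  induction t with
  | zero =>
    intro p _ j
    simp [powCoeff_apply]
  | succ t ih =>
    rw [pow_succ]
    exact (Ideal.mul_mono ih (map_C_sup_span_X_mul_map_C_le_ofCoeff h)).trans
      (ofCoeff_powCoeff_mul_le h t 1)

lemma ofCoeff_powCoeff_colon_X_pow_sup_span_X (h : I ≤ J) {t k : ℕ} (hk : k ≤ t) :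
    (ofCoeff (powCoeff h t)).colon {X ^ k} ⊔ Ideal.span {X} =
      (I ^ (t - k) * J ^ k).map C ⊔ Ideal.span {X} := by
  let b : ℕ →o Ideal R :=
    ⟨fun j ↦ powCoeff h t (j + k), fun i j hij ↦ (powCoeff h t).monotone (by omega)⟩
  have hb : b 0 = I ^ (t - k) * J ^ k := by
    change powCoeff h t (0 + k) = _
    rw [zero_add, powCoeff_apply, min_eq_left hk]
  rw [ofCoeff_colon_X_pow (b := b) fun _ ↦ rfl, ofCoeff_sup_span_X, hb]

lemma ofCoeff_powCoeff_colon_X_pow_self (h : I ≤ J) (t : ℕ) :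
    (ofCoeff (powCoeff h t)).colon {X ^ t} = (J ^ t).map C := by
  rw [ofCoeff_colon_X_pow (b := OrderHom.const ℕ (J ^ t)), ofCoeff_const]
  simp [powCoeff_apply]

end Powers

section LastVariable

open MvPolynomial

lemma depth_eq_grade (K σ M : Type*) [Field K] [AddCommGroup M] [Module (MvPolynomial σ K) M] :
    depth K σ M = grade (idealOfVars σ K) M :=
  rfl

lemma map_mem_map_ringEquiv_iff {A B : Type*} [CommRing A] [CommRing B] (e : A ≃+* B)
    {I : Ideal A} {x : A} : e x ∈ I.map e ↔ x ∈ I := by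
  rw [← Ideal.mem_comap, Ideal.comap_map_of_bijective e e.bijective]

lemma map_colon_singleton {A B : Type*} [CommRing A] [CommRing B] (e : A ≃+* B) (I : Ideal A)
    (x : A) : (I.colon {x}).map e = (I.map e).colon {e x} := by
  ext y
  obtain ⟨y, rfl⟩ := e.surjective y
  rw [map_mem_map_ringEquiv_iff, Submodule.mem_colon_singleton, Submodule.mem_colon_singleton,
    smul_eq_mul, smul_eq_mul, ← map_mul, map_mem_map_ringEquiv_iff]

lemma map_ringEquiv_injective {A B : Type*} [CommRing A] [CommRing B] (e : A ≃+* B) :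
    Function.Injective (Ideal.map e) :=
  Function.LeftInverse.injective fun _ ↦ Ideal.comap_map_of_bijective e e.bijective

lemma mem_idealOfVars_iff {σ R : Type*} [CommRing R] {p : MvPolynomial σ R} :
    p ∈ idealOfVars σ R ↔ constantCoeff p = 0 := by
  simpa [constantCoeff_eq, Finsupp.degree_eq_zero_iff] using mem_pow_idealOfVars_iff' 1 p

variable (K : Type*) [Field K] (N : ℕ)

/-- `K[x₁, …, x_{N+1}]` as the polynomial ring in the last variable over `K[x₁, …, x_N]`. -/
noncomputable def lastVarEquiv :
    MvPolynomial (Fin (N + 1)) K ≃+* Polynomial (MvPolynomial (Fin N) K) :=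
  ((renameEquiv K finSuccEquivLast).trans (optionEquivLeft K (Fin N))).toRingEquiv

variable {K N} {I J' : Ideal (MvPolynomial (Fin N) K)} {J : Ideal (MvPolynomial (Fin (N + 1)) K)}
  {a : ℕ →o Ideal (MvPolynomial (Fin N) K)}

lemma lastVarEquiv_X_last : lastVarEquiv K N (X (Fin.last N)) = Polynomial.X := by
  change optionEquivLeft K (Fin N) (rename finSuccEquivLast (X (Fin.last N))) = _
  rw [rename_X, finSuccEquivLast_last, optionEquivLeft_X_none]

lemma lastVarEquiv_incl (p : MvPolynomial (Fin N) K) :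
    lastVarEquiv K N (incl K (N + 1) p) = Polynomial.C p := by
  change optionEquivLeft K (Fin N) (rename finSuccEquivLast (rename Fin.castSucc p)) = _
  rw [rename_rename]
  induction p using MvPolynomial.induction_on with
  | C a => rw [rename_C, optionEquivLeft_C]
  | add p q hp hq => rw [map_add, map_add, map_add, hp, hq]
  | mul_X p i hp =>
    rw [map_mul, map_mul, hp, rename_X, Function.comp_apply, finSuccEquivLast_castSucc,
      optionEquivLeft_X_some, map_mul]

lemma map_lastVarEquiv_map_incl (Q : Ideal (MvPolynomial (Fin N) K)) :
    (Q.map (incl K (N + 1))).map (lastVarEquiv K N) = Q.map Polynomial.C := by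
  rw [← Ideal.map_coe (lastVarEquiv K N), Ideal.map_map]
  congr 1
  exact RingHom.ext lastVarEquiv_incl

lemma map_lastVarEquiv_idealOfVars :
    (idealOfVars (Fin (N + 1)) K).map (lastVarEquiv K N) =
      (idealOfVars (Fin N) K).map Polynomial.C ⊔ Ideal.span {Polynomial.X} := by
  rw [Ideal.map_span, Ideal.map_span, ← Ideal.span_union, ← Set.range_comp, ← Set.range_comp]
  congr 1
  ext f
  simp only [Set.mem_range, Set.mem_union, Set.mem_singleton_iff, Function.comp_apply]
  rw [Fin.exists_fin_succ', lastVarEquiv_X_last, eq_comm (a := Polynomial.X)]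
  simp only [← lastVarEquiv_incl, incl, AlgHom.toRingHom_eq_coe, RingHom.coe_coe, rename_X]
  rfl

lemma comap_incl_colon_X_last_pow (hJ : J.map (lastVarEquiv K N) = ofCoeff a) (j : ℕ) :
    (J.colon {X (Fin.last N) ^ j}).comap (incl K (N + 1)) = a j := by
  refine Ideal.ext fun p : MvPolynomial (Fin N) K ↦ ?_
  have hp : lastVarEquiv K N (incl K (N + 1) p * X (Fin.last N) ^ j) =
      Polynomial.C p * Polynomial.X ^ j := by
    rw [map_mul, map_pow, lastVarEquiv_incl, lastVarEquiv_X_last]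
  rw [Ideal.mem_comap, Submodule.mem_colon_singleton, smul_eq_mul,
    ← map_mem_map_ringEquiv_iff (lastVarEquiv K N), hp, hJ, C_mul_X_pow_mem_ofCoeff]

lemma depth_quotient_le_depth_quotient_add_one (hJ : J.map (lastVarEquiv K N) = ofCoeff a)
    {j : ℕ} (hj : a j ≤ idealOfVars (Fin N) K) :
    depth K (Fin (N + 1)) (MvPolynomial (Fin (N + 1)) K ⧸ J) ≤
      depth K (Fin N) (MvPolynomial (Fin N) K ⧸ a j) + 1 := by
  rw [depth_eq_grade, depth_eq_grade]
  refine (grade_quotient_le_grade_map (lastVarEquiv K N) _ J).trans ?_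
  rw [map_lastVarEquiv_idealOfVars, hJ]
  refine grade_quotient_ofCoeff_le_add_one ?_ hj
  exact (Ideal.ne_top_iff_one _).mpr fun h ↦
    one_ne_zero ((map_one _).symm.trans (mem_idealOfVars_iff.mp h))

section LinearInLastVariable

variable (h : I ≤ J')
  (hJ : J = I.map (incl K (N + 1)) ⊔ Ideal.span {X (Fin.last N)} * J'.map (incl K (N + 1)))

include hJ in
lemma pow_add_sup_span_X_last_pow (s k : ℕ) :
    J ^ (s + k) ⊔ Ideal.span {X (Fin.last N) ^ (k + 1)} =
      I.map (incl K (N + 1)) ^ s * J ^ k ⊔ Ideal.span {X (Fin.last N) ^ (k + 1)} := by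
  rw [hJ]
  exact sup_pow_add_sup_span_pow Ideal.mul_le_left s k

include h hJ

lemma map_lastVarEquiv_pow (t : ℕ) : (J ^ t).map (lastVarEquiv K N) = ofCoeff (powCoeff h t) := by
  rw [← pow_eq_ofCoeff, hJ, Ideal.map_pow, Ideal.map_sup, Ideal.map_mul, map_lastVarEquiv_map_incl,
    map_lastVarEquiv_map_incl, Ideal.map_span, Set.image_singleton, lastVarEquiv_X_last]

lemma pow_colon_X_last_pow_sup_span {t k : ℕ} (hk : k ≤ t) :
    (J ^ t).colon {X (Fin.last N) ^ k} ⊔ Ideal.span {X (Fin.last N)} =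
      (I ^ (t - k) * J' ^ k).map (incl K (N + 1)) ⊔ Ideal.span {X (Fin.last N)} := by
  refine map_ringEquiv_injective (lastVarEquiv K N) ?_
  rw [Ideal.map_sup, Ideal.map_sup, map_colon_singleton, map_lastVarEquiv_pow h hJ,
    map_lastVarEquiv_map_incl, Ideal.map_span, Set.image_singleton, map_pow, lastVarEquiv_X_last,
    ofCoeff_powCoeff_colon_X_pow_sup_span_X h hk]

lemma pow_colon_X_last_pow_self (t : ℕ) :
    (J ^ t).colon {X (Fin.last N) ^ t} = (J' ^ t).map (incl K (N + 1)) := by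
  refine map_ringEquiv_injective (lastVarEquiv K N) ?_
  rw [map_colon_singleton, map_lastVarEquiv_pow h hJ, map_lastVarEquiv_map_incl, map_pow,
    lastVarEquiv_X_last, ofCoeff_powCoeff_colon_X_pow_self]

lemma comap_incl_pow_colon_X_last_pow_self (t : ℕ) :
    ((J ^ t).colon {X (Fin.last N) ^ t}).comap (incl K (N + 1)) = J' ^ t := by
  rw [comap_incl_colon_X_last_pow (map_lastVarEquiv_pow h hJ t), powCoeff_self]

theorem depth_quotient_pow_le_depth_quotient_pow_add_one (hJ' : J' ≤ idealOfVars (Fin N) K) {t : ℕ}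
    (ht : t ≠ 0) :
    depth K (Fin (N + 1)) (MvPolynomial (Fin (N + 1)) K ⧸ J ^ t) ≤
      depth K (Fin N) (MvPolynomial (Fin N) K ⧸ J' ^ t) + 1 := by
  have hle : powCoeff h t t ≤ idealOfVars (Fin N) K :=
    (powCoeff_self h t).trans_le ((Ideal.pow_le_self ht).trans hJ')
  rw [← powCoeff_self h t]
  exact depth_quotient_le_depth_quotient_add_one (map_lastVarEquiv_pow h hJ t) hle

end LinearInLastVariable

end LastVariable

section Stanley

open MvPolynomial

variable {K σ : Type*} [Field K] {I J : Ideal (MvPolynomial σ K)}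

/-- Monomial ideals: together with a polynomial they contain all monomials that occur in it. -/
def IsMonomial (I : Ideal (MvPolynomial σ K)) : Prop :=
  ∀ p ∈ I, ∀ u ∈ p.support, monomial u (1 : K) ∈ I

lemma isMonomial_span {G : Set (MvPolynomial σ K)}
    (hG : G ⊆ Set.range fun u : σ →₀ ℕ ↦ monomial u (1 : K)) : IsMonomial (Ideal.span G) := by
  obtain ⟨s, rfl⟩ := Set.subset_range_iff_exists_image_eq.mp hG
  intro p hp u hu
  obtain ⟨v, hv, hvu⟩ := mem_ideal_span_monomial_image.mp hp u hu
  refine mem_ideal_span_monomial_image.mpr fun w hw ↦ ⟨v, hv, ?_⟩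
  rwa [Finset.mem_singleton.mp (support_monomial_subset hw)]

lemma IsMonomial.mul (hI : IsMonomial I) (hJ : IsMonomial J) : IsMonomial (I * J) := by
  classical
  refine fun p hp ↦ Submodule.mul_induction_on hp (fun q hq r hr u hu ↦ ?_) fun q r hq hr u hu ↦ ?_
  · obtain ⟨v, hv, w, hw, rfl⟩ := Finset.mem_add.mp (support_mul q r hu)
    rw [← one_mul (1 : K), ← monomial_mul]
    exact Ideal.mul_mem_mul (hI q hq v hv) (hJ r hr w hw)
  · exact (Finset.mem_union.mp (support_add hu)).elim (hq u) (hr u)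

lemma IsMonomial.pow (hI : IsMonomial I) (t : ℕ) : IsMonomial (I ^ t) := by
  induction t with
  | zero =>
    rw [pow_zero, Ideal.one_eq_top]
    exact fun _ _ _ _ ↦ Submodule.mem_top
  | succ t ih =>
    rw [pow_succ]
    exact ih.mul hI

lemma IsMonomial.linearIndependent_mk_monomial (hI : IsMonomial I) :
    LinearIndependent K fun u : {u : σ →₀ ℕ // monomial u (1 : K) ∉ I} ↦
      Ideal.Quotient.mkₐ K I (monomial u.1 1) := by
  refine ((basisMonomials σ K).linearIndependent.comp _ Subtype.val_injective).map
    (f := (Ideal.Quotient.mkₐ K I).toLinearMap) ?_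
  rw [Set.range_comp, coe_basisMonomials, ← restrictSupport_eq_span, Submodule.disjoint_def]
  intro p hp hpI
  rw [mem_restrictSupport_iff, Subtype.range_coe_subtype] at hp
  exact support_eq_empty.mp <| Finset.eq_empty_of_forall_notMem fun u hu ↦
    hp hu (hI p (Ideal.Quotient.eq_zero_iff_mem.mp hpI) u hu)

lemma span_range_mk_monomial_eq_top (I : Ideal (MvPolynomial σ K)) :
    Submodule.span K (Set.range fun u : {u : σ →₀ ℕ // monomial u (1 : K) ∉ I} ↦
      Ideal.Quotient.mkₐ K I (monomial u.1 1)) = ⊤ := by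
  have hmk : LinearMap.range (Ideal.Quotient.mkₐ K I).toLinearMap = ⊤ :=
    LinearMap.range_eq_top.mpr Ideal.Quotient.mk_surjective
  rw [← top_le_iff, ← hmk, LinearMap.range_eq_map, ← (basisMonomials σ K).span_eq,
    Submodule.map_span, Submodule.span_le, ← Set.range_comp, coe_basisMonomials]
  rintro _ ⟨u, rfl⟩
  by_cases hu : monomial u (1 : K) ∈ I
  · have h : (Ideal.Quotient.mkₐ K I).toLinearMap (monomial u 1) = 0 :=
      Ideal.Quotient.eq_zero_iff_mem.mpr hu
    rw [Function.comp_apply, h]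
    exact zero_mem _
  · exact Submodule.subset_span ⟨⟨u, hu⟩, rfl⟩

/-- The basis of `S ⧸ I`, for a monomial ideal `I`, given by the monomials not in `I`. -/
noncomputable def IsMonomial.basisQuotient (hI : IsMonomial I) :
    Module.Basis {u : σ →₀ ℕ // monomial u (1 : K) ∉ I} K (MvPolynomial σ K ⧸ I) :=
  .mk hI.linearIndependent_mk_monomial (span_range_mk_monomial_eq_top I).ge

lemma isInternal_span_basis_image_iff {ι κ V : Type*} [AddCommGroup V] [Module K V]
    [DecidableEq κ] (b : Module.Basis ι K V) (s : κ → Set ι) :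
    DirectSum.IsInternal (fun i ↦ Submodule.span K (b '' s i)) ↔
      Pairwise (Function.onFun Disjoint s) ∧ ⋃ i, s i = Set.univ := by
  have mem_span {j : ι} {v : Set ι} : b j ∈ Submodule.span K (b '' v) ↔ j ∈ v := by
    simp [b.mem_span_image]
  rw [DirectSum.isInternal_submodule_iff_iSupIndep_and_iSup_eq_top, ← Submodule.span_iUnion,
    ← Set.image_iUnion]
  refine and_congr ⟨fun h i j hij ↦ Set.disjoint_left.mpr fun l hli hlj ↦ ?_, fun h i ↦ ?_⟩
    ⟨fun h ↦ Set.eq_univ_of_forall fun j ↦ ?_, fun h ↦ ?_⟩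
  · exact b.ne_zero l (Submodule.disjoint_def.mp (h.pairwiseDisjoint hij) _ (mem_span.mpr hli)
      (mem_span.mpr hlj))
  · simp_rw [← Submodule.span_iUnion, ← Set.image_iUnion]
    exact b.linearIndependent.disjoint_span_image
      (Set.disjoint_iUnion₂_right.mpr fun j hj ↦ h hj.symm)
  · rw [← mem_span, h]
    exact Submodule.mem_top
  · rw [h, Set.image_univ, b.span_eq]

/-- The exponent vectors of the monomials in `x ^ a K[Z]`. -/
def cone (a : σ →₀ ℕ) (Z : Finset σ) : Set (σ →₀ ℕ) :=
  {u | a ≤ u ∧ ∀ l ∉ Z, u l = a l}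

lemma image_add_left_eq_cone (a : σ →₀ ℕ) (Z : Finset σ) :
    (a + ·) '' {c : σ →₀ ℕ | c.support ⊆ Z} = cone a Z := by
  ext u
  constructor
  · rintro ⟨c, hc, rfl⟩
    exact ⟨le_self_add, fun l hl ↦ by
      simpa using fun h ↦ hl (hc (Finsupp.mem_support_iff.mpr h))⟩
  · rintro ⟨hau, hu⟩
    obtain ⟨c, rfl⟩ := le_iff_exists_add.mp hau
    refine ⟨c, fun l hl ↦ ?_, rfl⟩
    by_contra hlZ
    exact Finsupp.mem_support_iff.mp hl (by simpa using hu l hlZ)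

lemma toSubmodule_supported (Z : Set σ) :
    Subalgebra.toSubmodule (supported K Z) =
      restrictSupport K {c : σ →₀ ℕ | ↑c.support ⊆ Z} := by
  ext p
  simp only [Subalgebra.mem_toSubmodule, mem_supported, mem_restrictSupport_iff, Set.subset_def,
    Finset.mem_coe, mem_vars_iff_mem_support, Set.mem_ofPred_eq]
  grind

lemma range_stanleyMap (I : Ideal (MvPolynomial σ K)) (a : σ →₀ ℕ) (Z : Finset σ) :
    LinearMap.range (stanleyMap I a Z) =
      Submodule.span K ((fun u ↦ Ideal.Quotient.mkₐ K I (monomial u 1)) '' cone a Z) := by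
  have hval : LinearMap.range (supported K (Z : Set σ)).val.toLinearMap =
      Submodule.span K ((monomial · 1) '' {c : σ →₀ ℕ | c.support ⊆ Z}) := by
    have h := toSubmodule_supported (K := K) (Z : Set σ)
    simp only [Finset.coe_subset] at h
    rw [← restrictSupport_eq_span, ← h]
    exact Submodule.range_subtype (Subalgebra.toSubmodule (supported K (Z : Set σ)))
  rw [stanleyMap, LinearMap.range_comp, LinearMap.range_comp, hval, Submodule.map_span,
    Submodule.map_span, ← image_add_left_eq_cone, Set.image_image, Set.image_image, Set.image_image]
  simp [monomial_mul]

lemma IsMonomial.injective_stanleyMap_iff (hI : IsMonomial I) (a : σ →₀ ℕ) (Z : Finset σ) :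
    Function.Injective (stanleyMap I a Z) ↔ ∀ u ∈ cone a Z, monomial u (1 : K) ∉ I := by
  have stanleyMap_eq_zero {p : supported K (Z : Set σ)} :
      stanleyMap I a Z p = 0 ↔ monomial a (1 : K) * p ∈ I := Ideal.Quotient.eq_zero_iff_mem
  simp_rw [injective_iff_map_eq_zero, stanleyMap_eq_zero, ← image_add_left_eq_cone,
    Set.forall_mem_image]
  constructor
  · intro h c hc hmem
    have hcZ : monomial c (1 : K) ∈ supported K (Z : Set σ) := by
      rw [← Subalgebra.mem_toSubmodule, toSubmodule_supported]
      exact (monomial_mem_restrictSupport (R := K)).mpr (Or.inl (by exact_mod_cast hc))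
    have := h ⟨_, hcZ⟩ (by rwa [monomial_mul, one_mul])
    simpa using congrArg Subtype.val this
  · rintro h ⟨p, hp⟩ hpI
    rw [← Subalgebra.mem_toSubmodule, toSubmodule_supported, mem_restrictSupport_iff] at hp
    refine Subtype.ext (support_eq_empty.mp (Finset.eq_empty_of_forall_notMem fun c hc ↦ ?_))
    refine h (hp hc) (hI _ hpI _ ?_)
    simpa [mem_support_iff, coeff_monomial_mul] using hc

/-- A partition of the monomials not in `I` into cones. For a monomial ideal `I` these are the
Stanley decompositions of `S ⧸ I`. -/
structure IsStanleyPartition (I : Ideal (MvPolynomial σ K)) {ι : Type*} (a : ι → σ →₀ ℕ)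
    (Z : ι → Finset σ) : Prop where
  pairwise_disjoint : Pairwise (Function.onFun Disjoint fun i ↦ cone (a i) (Z i))
  iUnion_eq : ⋃ i, cone (a i) (Z i) = {u | monomial u (1 : K) ∉ I}

lemma IsMonomial.range_stanleyMap_eq_span_basisQuotient (hI : IsMonomial I) {a : σ →₀ ℕ}
    {Z : Finset σ} (h : ∀ u ∈ cone a Z, monomial u (1 : K) ∉ I) :
    LinearMap.range (stanleyMap I a Z) =
      Submodule.span K (hI.basisQuotient '' (Subtype.val ⁻¹' cone a Z)) := by
  have hb : ⇑hI.basisQuotient = (fun u ↦ Ideal.Quotient.mkₐ K I (monomial u 1)) ∘ Subtype.val :=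
    Module.Basis.coe_mk _ _
  rw [hb, Set.image_comp, Set.image_preimage_eq_inter_range, Subtype.range_coe_subtype,
    Set.inter_eq_left.mpr (show cone a Z ⊆ {u | monomial u (1 : K) ∉ I} from h), range_stanleyMap]

lemma IsMonomial.isInternal_range_stanleyMap_iff (hI : IsMonomial I) {ι : Type*} [DecidableEq ι]
    {a : ι → σ →₀ ℕ} {Z : ι → Finset σ}
    (h : ∀ i, ∀ u ∈ cone (a i) (Z i), monomial u (1 : K) ∉ I) :
    DirectSum.IsInternal (fun i ↦ LinearMap.range (stanleyMap I (a i) (Z i))) ↔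
      IsStanleyPartition I a Z := by
  simp_rw [hI.range_stanleyMap_eq_span_basisQuotient (h _)]
  rw [isInternal_span_basis_image_iff, ← Set.preimage_iUnion, Set.preimage_eq_univ_iff,
    Subtype.range_coe_subtype]
  constructor
  · rintro ⟨hdisj, hU⟩
    refine ⟨fun i j hij ↦ Set.disjoint_left.mpr fun u hi ↦ ?_,
      (Set.iUnion_subset h).antisymm hU⟩
    have hdisj := Set.disjoint_left.mp (hdisj hij)
    exact hdisj (a := ⟨u, h i u hi⟩) hi
  · rintro ⟨hdisj, hU⟩
    exact ⟨fun i j hij ↦ (hdisj hij).preimage _, hU.ge⟩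

lemma IsMonomial.isStanleyPartition_iff (hI : IsMonomial I) {ι : Type*} [DecidableEq ι]
    {a : ι → σ →₀ ℕ} {Z : ι → Finset σ} :
    IsStanleyPartition I a Z ↔ (∀ i, Function.Injective (stanleyMap I (a i) (Z i))) ∧
      DirectSum.IsInternal fun i ↦ LinearMap.range (stanleyMap I (a i) (Z i)) := by
  simp_rw [hI.injective_stanleyMap_iff]
  refine ⟨fun hp ↦ ?_, fun ⟨h, hint⟩ ↦ (hI.isInternal_range_stanleyMap_iff h).mp hint⟩
  have h (i : ι) (u : σ →₀ ℕ) (hu : u ∈ cone (a i) (Z i)) : monomial u (1 : K) ∉ I :=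
    hp.iUnion_eq.subset (Set.mem_iUnion_of_mem i hu)
  exact ⟨h, (hI.isInternal_range_stanleyMap_iff h).mpr hp⟩

lemma IsMonomial.isStanleyPartition (hI : IsMonomial I) (D : StanleyDecomposition I) :
    IsStanleyPartition I D.a D.Z :=
  hI.isStanleyPartition_iff.mpr ⟨D.free, D.isInternal⟩

lemma IsStanleyPartition.le_sdepth {ι : Type*} [Finite ι] {a : ι → σ →₀ ℕ} {Z : ι → Finset σ}
    (h : IsStanleyPartition I a Z) (hI : IsMonomial I) : ⨅ i, ((Z i).card : ℕ∞) ≤ sdepth I := by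
  let e := Finite.equivFin ι
  have he : IsStanleyPartition I (a ∘ e.symm) (Z ∘ e.symm) :=
    ⟨h.pairwise_disjoint.comp_of_injective e.symm.injective, by
      rw [← h.iUnion_eq]
      exact e.symm.surjective.iUnion_comp fun i ↦ cone (a i) (Z i)⟩
  obtain ⟨free, isInternal⟩ := hI.isStanleyPartition_iff.mp he
  refine le_iSup_of_le ⟨_, _, _, free, isInternal⟩ (le_iInf fun i ↦ iInf_le _ (e.symm i))

end Stanley

section StanleySlice

open MvPolynomial

variable {K : Type*} [Field K] {N : ℕ} {J : Ideal (MvPolynomial (Fin (N + 1)) K)}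

/-- The exponent vector `u` in the first `N` variables, extended by the exponent `T` of the last
variable. -/
noncomputable def snocExp (u : Fin N →₀ ℕ) (T : ℕ) : Fin (N + 1) →₀ ℕ :=
  u.mapDomain Fin.castSucc + Finsupp.single (Fin.last N) T

lemma snocExp_castSucc (u : Fin N →₀ ℕ) (T : ℕ) (i : Fin N) :
    snocExp u T i.castSucc = u i := by
  rw [snocExp, Finsupp.add_apply, Finsupp.mapDomain_apply (Fin.castSucc_injective N),
    Finsupp.single_eq_of_ne (Fin.castSucc_lt_last i).ne, add_zero]

lemma snocExp_last (u : Fin N →₀ ℕ) (T : ℕ) : snocExp u T (Fin.last N) = T := by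
  have h : Fin.last N ∉ Set.range Fin.castSucc := fun ⟨i, hi⟩ ↦ (Fin.castSucc_lt_last i).ne hi
  rw [snocExp, Finsupp.add_apply, Finsupp.mapDomain_of_notMem_range _ _ h, Finsupp.single_eq_same,
    zero_add]

lemma monomial_snocExp (u : Fin N →₀ ℕ) (T : ℕ) (r : K) :
    monomial (snocExp u T) r = incl K (N + 1) (monomial u r) * X (Fin.last N) ^ T := by
  change _ = rename Fin.castSucc _ * _
  rw [rename_monomial, X_pow_eq_monomial, monomial_mul, mul_one, snocExp]

/-- The exponent vector `u` without its last entry. -/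
noncomputable def initExp (u : Fin (N + 1) →₀ ℕ) : Fin N →₀ ℕ :=
  Finsupp.equivFunOnFinite.symm fun i ↦ u i.castSucc

/-- The variables in `Z` other than the last one, as variables of the smaller polynomial ring. -/
def initVars (Z : Finset (Fin (N + 1))) : Finset (Fin N) :=
  {l | l.castSucc ∈ Z}

lemma card_le_card_initVars_add_one (Z : Finset (Fin (N + 1))) :
    Z.card ≤ (initVars Z).card + 1 := by
  have hZ : Z ⊆ insert (Fin.last N) ((initVars Z).image Fin.castSucc) := by
    intro l hl
    induction l using Fin.lastCases with
    | last => simp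
    | cast l => simpa [initVars] using hl
  exact (Finset.card_le_card hZ).trans
    ((Finset.card_insert_le _ _).trans (Nat.add_le_add_right Finset.card_image_le 1))

lemma snocExp_mem_cone_iff {a : Fin (N + 1) →₀ ℕ} {Z : Finset (Fin (N + 1))} {u : Fin N →₀ ℕ}
    {T : ℕ} : snocExp u T ∈ cone a Z ↔ u ∈ cone (initExp a) (initVars Z) ∧
      a (Fin.last N) ≤ T ∧ (Fin.last N ∉ Z → T = a (Fin.last N)) := by
  simp only [cone, Set.mem_ofPred_eq, Finsupp.le_def, Fin.forall_fin_succ', snocExp_castSucc,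
    snocExp_last, initExp, initVars, Finsupp.equivFunOnFinite_symm_apply_apply, Finset.mem_filter,
    Finset.mem_univ, true_and]
  tauto

lemma monomial_mem_comap_incl_colon_iff {u : Fin N →₀ ℕ} {T : ℕ} :
    monomial u (1 : K) ∈ (J.colon {X (Fin.last N) ^ T}).comap (incl K (N + 1)) ↔
      monomial (snocExp u T) 1 ∈ J := by
  rw [Ideal.mem_comap, Submodule.mem_colon_singleton, smul_eq_mul, monomial_snocExp]

lemma IsMonomial.comap_incl_colon (hJ : IsMonomial J) (T : ℕ) :
    IsMonomial ((J.colon {X (Fin.last N) ^ T}).comap (incl K (N + 1))) := by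
  intro (p : MvPolynomial (Fin N) K) hp (u : Fin N →₀ ℕ) hu
  have hpJ : incl K (N + 1) p * X (Fin.last N) ^ T ∈ J := Submodule.mem_colon_singleton.mp hp
  have hcoeff : coeff (snocExp u T) (incl K (N + 1) p * X (Fin.last N) ^ T) = coeff u p := by
    change coeff _ (rename Fin.castSucc p * _) = _
    rw [snocExp, X_pow_eq_monomial, coeff_mul_monomial, mul_one,
      coeff_rename_mapDomain _ (Fin.castSucc_injective N)]
  rw [monomial_mem_comap_incl_colon_iff]
  exact hJ _ hpJ _ (by rwa [mem_support_iff, hcoeff, ← mem_support_iff])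

theorem sdepth_le_sdepth_comap_colon_add_one (hJ : IsMonomial J) (T : ℕ) :
    sdepth J ≤ sdepth ((J.colon {X (Fin.last N) ^ T}).comap (incl K (N + 1))) + 1 := by
  refine iSup_le fun D ↦ ?_
  have hD := hJ.isStanleyPartition D
  let κ := {i : Fin D.r // D.a i (Fin.last N) ≤ T ∧
    (Fin.last N ∉ D.Z i → T = D.a i (Fin.last N))}
  have mem_cone_iff (i : κ) (u : Fin N →₀ ℕ) :
      u ∈ cone (initExp (D.a i)) (initVars (D.Z i)) ↔ snocExp u T ∈ cone (D.a i) (D.Z i) := by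
    rw [snocExp_mem_cone_iff, and_iff_left i.2]
  have hpart : IsStanleyPartition ((J.colon {X (Fin.last N) ^ T}).comap (incl K (N + 1)))
      (fun i : κ ↦ initExp (D.a i)) (fun i : κ ↦ initVars (D.Z i)) := by
    refine ⟨fun i j hij ↦ Set.disjoint_left.mpr fun u hi hj ↦ ?_, ?_⟩
    · rw [mem_cone_iff] at hi hj
      exact Set.disjoint_left.mp (hD.pairwise_disjoint (Subtype.val_injective.ne hij)) hi hj
    · ext u
      rw [Set.mem_iUnion, Set.mem_ofPred_eq, monomial_mem_comap_incl_colon_iff]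
      have h := Set.ext_iff.mp hD.iUnion_eq (snocExp u T)
      rw [Set.mem_iUnion, Set.mem_ofPred_eq] at h
      rw [← h]
      exact ⟨fun ⟨i, hi⟩ ↦ ⟨i, (mem_cone_iff i u).mp hi⟩, fun ⟨i, hi⟩ ↦
        ⟨⟨i, (snocExp_mem_cone_iff.mp hi).2⟩, (snocExp_mem_cone_iff.mp hi).1⟩⟩
  calc
    D.sdepth ≤ ⨅ i : κ, ((initVars (D.Z i)).card + 1 : ℕ∞) :=
      le_iInf fun i ↦ (iInf_le _ i.1).trans (by exact_mod_cast card_le_card_initVars_add_one _)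
    _ = (⨅ i : κ, ((initVars (D.Z i)).card : ℕ∞)) + 1 := ENat.iInf_add.symm
    _ ≤ _ := add_le_add_left (hpart.le_sdepth (hJ.comap_incl_colon T)) 1

end StanleySlice

section Cycle

open MvPolynomial

variable {K : Type*} [Field K] {N m : ℕ}

lemma prod_filter_X_eq (P : ℕ → Prop) [DecidablePred P] :
    ∏ l : Fin (N + 1) with P l.val, (X l : MvPolynomial (Fin (N + 1)) K) =
      (if P N then X (Fin.last N) else 1) *
        incl K (N + 1) (∏ l : Fin N with P l.val, X l) := by
  rw [Finset.prod_filter, Fin.prod_univ_castSucc, Finset.prod_filter, map_prod, mul_comm]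
  congr 1
  refine Finset.prod_congr rfl fun l _ ↦ ?_
  rw [apply_ite (incl K (N + 1)), map_one]
  change _ = if P l then rename Fin.castSucc (X l) else 1
  rw [rename_X, Fin.val_castSucc]

lemma map_incl_pathIdeal_le_cycleIdeal :
    (pathIdeal K N m).map (incl K (N + 1)) ≤ cycleIdeal K (N + 1) m := by
  refine Ideal.map_le_iff_le_comap.mpr (Ideal.span_le.mpr ?_)
  rintro _ ⟨i, hi, rfl⟩
  refine Ideal.mem_sup_left (Ideal.subset_span ⟨i, by omega, ?_⟩)
  rw [prod_filter_X_eq fun l ↦ i ≤ l ∧ l < i + m, if_neg (by omega), one_mul]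

lemma cycleIdeal_eq_map_incl_sup (hm : 0 < m) :
    cycleIdeal K (N + 1) m = (pathIdeal K N m).map (incl K (N + 1)) ⊔
      Ideal.span {X (Fin.last N)} *
        (((cycleIdeal K (N + 1) m).colon {X (Fin.last N)}).comap (incl K (N + 1))).map
          (incl K (N + 1)) := by
  set J := cycleIdeal K (N + 1) m
  set J' := (J.colon {X (Fin.last N)}).comap (incl K (N + 1)) with hJ'
  have mem_J' {g : MvPolynomial (Fin N) K} : g ∈ J' ↔ X (Fin.last N) * incl K (N + 1) g ∈ J := by
    rw [hJ', Ideal.mem_comap, Submodule.mem_colon_singleton, smul_eq_mul, mul_comm]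
  refine le_antisymm ?_ (sup_le map_incl_pathIdeal_le_cycleIdeal ?_)
  · have mem_right {P : ℕ → Prop} [DecidablePred P] (hP : P N)
        (h : ∏ l : Fin (N + 1) with P l.val, X l ∈ J) : ∏ l : Fin (N + 1) with P l.val, X l ∈
          Ideal.span {X (Fin.last N)} * J'.map (incl K (N + 1)) := by
      rw [prod_filter_X_eq P, if_pos hP] at h ⊢
      exact Ideal.mul_mem_mul (Ideal.mem_span_singleton_self _)
        (Ideal.mem_map_of_mem _ (mem_J'.mpr h))
    refine sup_le (Ideal.span_le.mpr ?_) (Ideal.span_le.mpr ?_)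
    · rintro _ ⟨i, hi, rfl⟩
      by_cases hN : i ≤ N ∧ N < i + m
      · exact Ideal.mem_sup_right (mem_right (P := fun l ↦ i ≤ l ∧ l < i + m) hN
          (Ideal.mem_sup_left (Ideal.subset_span ⟨i, hi, rfl⟩)))
      · rw [SetLike.mem_coe, prod_filter_X_eq fun l ↦ i ≤ l ∧ l < i + m, if_neg hN, one_mul]
        exact Ideal.mem_sup_left (Ideal.mem_map_of_mem _ (Ideal.subset_span ⟨i, by omega, rfl⟩))
    · rintro _ ⟨i, hi, him, rfl⟩
      exact Ideal.mem_sup_right (mem_right (P := fun l ↦ i ≤ l ∨ l + (N + 1) < i + m) (by omega)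
        (Ideal.mem_sup_right (Ideal.subset_span ⟨i, hi, him, rfl⟩)))
  · have hJ'J : J'.map (incl K (N + 1)) ≤ J.colon {X (Fin.last N)} := Ideal.map_comap_le
    refine Ideal.span_singleton_mul_le_iff.mpr fun z hz ↦ ?_
    rw [mul_comm]
    exact Submodule.mem_colon_singleton.mp (hJ'J hz)

lemma pathIdeal_le_comap_colon :
    pathIdeal K N m ≤ ((cycleIdeal K (N + 1) m).colon {X (Fin.last N)}).comap (incl K (N + 1)) :=
  (Ideal.map_le_iff_le_comap.mp map_incl_pathIdeal_le_cycleIdeal).trans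
    (Ideal.comap_mono Ideal.le_colon)

lemma comap_colon_le_idealOfVars (hm : 2 ≤ m) (hN : 0 < N) :
    ((cycleIdeal K (N + 1) m).colon {X (Fin.last N)}).comap (incl K (N + 1)) ≤
      idealOfVars (Fin N) K := by
  let φ : MvPolynomial (Fin (N + 1)) K →+* K := eval (Fin.snoc (α := fun _ ↦ K) 0 1)
  have hφ (P : ℕ → Prop) [DecidablePred P] (l : Fin N) (hl : P l) :
      ∏ l : Fin (N + 1) with P l.val, X l ∈ RingHom.ker φ := by
    rw [RingHom.mem_ker, map_prod]
    refine Finset.prod_eq_zero (i := l.castSucc) (by simpa using hl) ?_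
    simp [φ]
  have hJ : cycleIdeal K (N + 1) m ≤ RingHom.ker φ := by
    refine sup_le (Ideal.span_le.mpr ?_) (Ideal.span_le.mpr ?_)
    · rintro _ ⟨i, _, rfl⟩
      exact hφ (fun l ↦ i ≤ l ∧ l < i + m) ⟨i, by omega⟩ (by dsimp only; omega)
    · rintro _ ⟨i, _, him, rfl⟩
      exact hφ (fun l ↦ i ≤ l ∨ l + (N + 1) < i + m) ⟨0, hN⟩ (by dsimp only; omega)
  intro g hg
  have h := hJ (Submodule.mem_colon_singleton.mp hg)
  have hincl : φ.comp (incl K (N + 1)) = constantCoeff := by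
    refine ringHom_ext (fun r ↦ ?_) fun l ↦ ?_
    · simp [φ, incl]
    · change eval _ (rename Fin.castSucc (X l)) = _
      simp
  rw [mem_idealOfVars_iff, ← hincl, RingHom.comp_apply]
  simpa [φ] using h

lemma isMonomial_cycleIdeal (n : ℕ) : IsMonomial (cycleIdeal K n m) := by
  have prod_X_mem_range (s : Finset (Fin n)) :
      ∏ l ∈ s, X l ∈ Set.range fun u : Fin n →₀ ℕ ↦ monomial u (1 : K) :=
    ⟨∑ l ∈ s, Finsupp.single l 1, monomial_sum_one s fun l ↦ Finsupp.single l 1⟩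
  rw [cycleIdeal, pathIdeal, ← Ideal.span_union]
  apply isMonomial_span
  rintro _ (⟨i, -, rfl⟩ | ⟨i, -, -, rfl⟩) <;> exact prod_X_mem_range _

end Cycle

end CyclePath

open CyclePath in
theorem lemma3p1 (K : Type*) [Field K] (n m t : ℕ) (hm : 2 ≤ m) (hmn : m < n) (ht : 1 ≤ t) :
    let x : MvPolynomial (Fin n) K := MvPolynomial.X ⟨n - 1, by omega⟩
    let J : Ideal (MvPolynomial (Fin n) K) := cycleIdeal K n m
    let J' : Ideal (MvPolynomial (Fin (n - 1)) K) := (J.colon {x}).comap (incl K n)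
    let I : Ideal (MvPolynomial (Fin (n - 1)) K) := pathIdeal K (n - 1) m
    (∀ k : ℕ, 1 ≤ k → k ≤ t →
      J ^ t ⊔ Ideal.span {x ^ k} =
        I.map (incl K n) ^ (t + 1 - k) * J ^ (k - 1) ⊔ Ideal.span {x ^ k}) ∧
    (∀ k : ℕ, 1 ≤ k → k ≤ t →
      (J ^ t).colon {x ^ (k - 1)} ⊔ Ideal.span {x} =
        (I ^ (t + 1 - k) * J' ^ (k - 1)).map (incl K n) ⊔ Ideal.span {x}) ∧
    (J ^ t ⊔ Ideal.span {x} = (I ^ t).map (incl K n) ⊔ Ideal.span {x} ∧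
      (J ^ t).colon {x ^ t} = (J' ^ t).map (incl K n)) ∧
    (depth K (Fin n) (MvPolynomial (Fin n) K ⧸ J ^ t) ≤
        depth K (Fin (n - 1)) (MvPolynomial (Fin (n - 1)) K ⧸ J' ^ t) + 1 ∧
      sdepth (J ^ t) ≤ sdepth (J' ^ t) + 1) := by
  obtain ⟨N, rfl⟩ : ∃ N, n = N + 1 := ⟨n - 1, by omega⟩
  intro x J J' I
  have h : I ≤ J' := pathIdeal_le_comap_colon
  have hJ : J = I.map (incl K (N + 1)) ⊔ Ideal.span {x} * J'.map (incl K (N + 1)) :=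
    cycleIdeal_eq_map_incl_sup (by omega)
  refine ⟨fun k hk hkt ↦ ?_, fun k hk hkt ↦ ?_, ⟨?_, pow_colon_X_last_pow_self h hJ t⟩, ?_, ?_⟩
  · obtain ⟨k, rfl⟩ := Nat.exists_eq_add_of_le' hk
    obtain ⟨s, rfl⟩ := Nat.exists_eq_add_of_le' (Nat.le_of_succ_le hkt)
    rw [show s + k + 1 - (k + 1) = s by omega]
    exact pow_add_sup_span_X_last_pow hJ s k
  · rw [show t + 1 - k = t - (k - 1) by omega]
    exact pow_colon_X_last_pow_sup_span h hJ (by omega)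
  · have hzero := pow_add_sup_span_X_last_pow hJ t 0
    rwa [zero_add, pow_one, pow_zero, mul_one, ← Ideal.map_pow] at hzero
  · exact depth_quotient_pow_le_depth_quotient_pow_add_one h hJ
      (comap_colon_le_idealOfVars hm (by omega)) (by omega)
  · rw [← comap_incl_pow_colon_X_last_pow_self h hJ t]
    exact sdepth_le_sdepth_comap_colon_add_one ((isMonomial_cycleIdeal _).pow t) t
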